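/- Let $1 \le n \le 4$ and let $A$ be an $n \times n$ complex matrix that is a partial isometry, that is, $A A^* A = A$, where $A^*$ denotes the conjugate transpose of $A$. Then $A$ is unitarily similar to its transpose $A^{\mathsf{T}}$: there is a unitary $n \times n$ complex matrix $U$ such that $A = U A^{\mathsf{T}} U^*$. -/

import Mathlib

open scoped Matrix

/-- A complex square matrix is a partial isometry if `A A* A = A`, where `A*` is the conjugate
transpose. -/
def IsPartialIsometry {n : ℕ} (A : Matrix (Fin n) (Fin n) ℂ) : Prop :=
  A * Aᴴ * A = A

/-- `A` and `B` are unitarily similar if `A = U B U*` for some unitary matrix `U`. -/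
def UnitarilySimilar {n : ℕ} (A B : Matrix (Fin n) (Fin n) ℂ) : Prop :=
  ∃ U ∈ Matrix.unitaryGroup (Fin n) ℂ, A = U * B * Uᴴ

/-! `P = Aᴴ * A` is an orthogonal projection, and for `n ≤ 4` its rank is at most 2 or its corank at
most 1. Rank at most 2: `A = Y * Xᴴ` with `X`, `Y` having orthonormal columns. Up to a left unitary,
the pair `(X, Y)` is determined by `Xᴴ * Y`, and passing to `Aᵀ` transposes this compression. So it
suffices that a matrix of size at most 2 is unitarily similar to its transpose
(`Matrix.exists_unitary_transpose_fin_two`). Corank at most 1: `A = W * P` with `W` unitary and `P =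
1 - v vᴴ`. A unitary `Z` with `Z * Wᵀ = W * Z` and `Z *ᵥ star v = v`
(`Matrix.exists_unitary_symmetrizing_unitary_and_vector`) gives `Z * Aᵀ * Zᴴ = P * W = Wᴴ * A * W`.
-/

/-! ### Gram matrices and left unitary equivalence -/

theorem LinearMap.exists_linearIsometry_comp_eq_of_norm_eq {E F : Type*} [AddCommGroup E]
    [Module ℂ E] [NormedAddCommGroup F] [InnerProductSpace ℂ F] [FiniteDimensional ℂ F]
    (f g : E →ₗ[ℂ] F) (h : ∀ x, ‖f x‖ = ‖g x‖) : ∃ u : F →ₗᵢ[ℂ] F, ∀ x, u (f x) = g x := by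
  obtain ⟨s, hs⟩ := f.rangeRestrict.exists_rightInverse_of_surjective f.range_rangeRestrict
  have hs' : ∀ y : LinearMap.range f, f (s y) = y := fun y =>
    congrArg Subtype.val (LinearMap.congr_fun hs y)
  -- The map `f x ↦ g x`, defined through a linear section `s` of `f`; equality of norms gives `ker
  -- f = ker g`, so the section does not matter.
  let L : LinearMap.range f →ₗᵢ[ℂ] F :=
    { toLinearMap := g ∘ₗ s
      norm_map' := fun y => by
        change ‖g (s y)‖ = ‖y‖
        rw [← h, hs']; rfl }
  refine ⟨L.extend, fun x => ?_⟩
  have h1 : L.extend (f x) = L ⟨f x, x, rfl⟩ := L.extend_apply ⟨f x, x, rfl⟩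
  rw [h1]
  change g (s ⟨f x, x, rfl⟩) = g x
  rw [← sub_eq_zero, ← map_sub, ← norm_eq_zero, ← h, map_sub, hs', sub_self, norm_zero]

theorem Matrix.exists_unitary_mul_eq_of_gram_eq {n m : Type*} [Fintype n] [DecidableEq n]
    [Fintype m] [DecidableEq m] {M N : Matrix n m ℂ} (h : Mᴴ * M = Nᴴ * N) :
    ∃ U ∈ Matrix.unitaryGroup n ℂ, U * M = N := by
  have key : ∀ (K : Matrix n m ℂ) (x : EuclideanSpace ℂ m),
      ((‖Matrix.toEuclideanLin K x‖ ^ 2 : ℝ) : ℂ) = star x.ofLp ⬝ᵥ ((Kᴴ * K) *ᵥ x.ofLp) := by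
    intro K x
    have := inner_self_eq_norm_sq_to_K (𝕜 := ℂ) (Matrix.toEuclideanLin K x)
    rw [EuclideanSpace.inner_eq_star_dotProduct] at this
    push_cast
    refine this.symm.trans ?_
    rw [← Matrix.mulVec_mulVec, Matrix.dotProduct_mulVec, ← Matrix.star_mulVec, dotProduct_comm]
    rfl
  obtain ⟨u, hu⟩ := LinearMap.exists_linearIsometry_comp_eq_of_norm_eq
    (Matrix.toEuclideanLin M) (Matrix.toEuclideanLin N) (fun x => by
      have h1 : ((‖Matrix.toEuclideanLin M x‖ ^ 2 : ℝ) : ℂ) = ((‖Matrix.toEuclideanLin N x‖ ^ 2 : ℝ) : ℂ) := by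
        rw [key, key, h]
      exact (sq_eq_sq₀ (norm_nonneg _) (norm_nonneg _)).1 (Complex.ofReal_injective h1))
  let b := EuclideanSpace.basisFun n ℂ
  obtain ⟨U, hU⟩ := (Matrix.toEuclideanLin (𝕜 := ℂ) (m := n) (n := n)).surjective u.toLinearMap
  have hU' : ∀ x, Matrix.toEuclideanLin U x = u x := fun x => by rw [hU]; rfl
  refine ⟨U, ?_, ?_⟩
  · rw [Matrix.mem_unitaryGroup_iff']
    ext i j
    have h1 := u.inner_map_map (b i) (b j)
    rw [← hU', ← hU', orthonormal_iff_ite.1 b.orthonormal] at h1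
    simp only [b, EuclideanSpace.basisFun_apply, EuclideanSpace.inner_eq_star_dotProduct,
      Matrix.toLpLin_apply, PiLp.ofLp_single, Matrix.mulVec_single_one] at h1
    rw [Matrix.one_apply, ← h1, Matrix.mul_apply]
    simp [dotProduct, Matrix.star_apply, mul_comm]
  · ext i j
    have h1 := hu (WithLp.toLp 2 (Pi.single j 1))
    rw [← hU'] at h1
    have h2 := congrFun (congrArg WithLp.ofLp h1) i
    simp only [Matrix.toLpLin_apply, Matrix.mulVec_single_one] at h2
    exact h2

theorem Matrix.exists_unitary_mul_pair_eq {n m : Type*} [Fintype n] [DecidableEq n]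
    [Fintype m] [DecidableEq m] {X Y X' Y' : Matrix n m ℂ} (hX : Xᴴ * X = 1) (hY : Yᴴ * Y = 1)
    (hX' : X'ᴴ * X' = 1) (hY' : Y'ᴴ * Y' = 1) (h : Xᴴ * Y = X'ᴴ * Y') :
    ∃ U ∈ Matrix.unitaryGroup n ℂ, U * X = X' ∧ U * Y = Y' := by
  have h' : Yᴴ * X = Y'ᴴ * X' := by
    simpa [Matrix.conjTranspose_mul] using congrArg Matrix.conjTranspose h
  -- The Gram matrix of the block matrix `[X Y]` has diagonal blocks 1 and off-diagonal blocks `Xᴴ *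
  -- Y` and its adjoint.
  obtain ⟨U, hU, hUM⟩ := Matrix.exists_unitary_mul_eq_of_gram_eq
    (M := Matrix.fromCols X Y) (N := Matrix.fromCols X' Y') (by
      simp only [Matrix.conjTranspose_fromCols_eq_fromRows_conjTranspose,
        Matrix.fromRows_mul_fromCols, hX, hY, hX', hY', h, h'])
  rw [Matrix.mul_fromCols, Matrix.fromCols_inj.eq_iff] at hUM
  exact ⟨U, hU, hUM⟩

/-- If the compression `Xᴴ * Y` of `Y * Xᴴ` is unitarily similar to its transpose,
so is `Y * Xᴴ`. -/
theorem Matrix.exists_unitary_mul_conjTranspose_transpose {n m : Type*} [Fintype n] [DecidableEq n]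
    [Fintype m] [DecidableEq m] {X Y : Matrix n m ℂ} (hX : Xᴴ * X = 1) (hY : Yᴴ * Y = 1)
    {Q : Matrix m m ℂ} (hQ : Q ∈ Matrix.unitaryGroup m ℂ)
    (h : Xᴴ * Y = Q * (Xᴴ * Y)ᵀ * Qᴴ) :
    ∃ U ∈ Matrix.unitaryGroup n ℂ, Y * Xᴴ = U * (Y * Xᴴ)ᵀ * Uᴴ := by
  have hQ1 : Q * Qᴴ = 1 := Matrix.mem_unitaryGroup_iff.1 hQ
  have hQ2 : Qᴴ * Q = 1 := Matrix.mem_unitaryGroup_iff'.1 hQ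
  have conj_isom : ∀ Z : Matrix n m ℂ, Zᴴ * Z = 1 →
      (Zᴴᵀ * Qᴴ)ᴴ * (Zᴴᵀ * Qᴴ) = 1 := by
    intro Z hZ
    have h1 : Zᵀ * Zᴴᵀ = 1 := by rw [← Matrix.transpose_mul, hZ, Matrix.transpose_one]
    have h2 : Zᴴᵀᴴ = Zᵀ := by ext; simp
    rw [Matrix.conjTranspose_mul, Matrix.conjTranspose_conjTranspose, h2, Matrix.mul_assoc,
      ← Matrix.mul_assoc Zᵀ, h1, Matrix.one_mul, hQ1]
  have h2 : Yᴴᵀᴴ = Yᵀ := by ext; simp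
  -- `Zᴴᵀ` is the entrywise conjugate of `Z`. Transposition swaps the roles of `X` and `Y`, and the
  -- factor `Qᴴ` turns the Gram block `(Xᴴ * Y)ᵀ` into `Q * (Xᴴ * Y)ᵀ * Qᴴ`.
  obtain ⟨U, hU, hU1, hU2⟩ := Matrix.exists_unitary_mul_pair_eq (conj_isom Y hY) (conj_isom X hX)
    hX hY (by
      rw [Matrix.conjTranspose_mul, Matrix.conjTranspose_conjTranspose, h2, h,
        Matrix.transpose_mul]
      simp only [Matrix.mul_assoc])
  refine ⟨U, hU, ?_⟩
  calc Y * Xᴴ = U * (Xᴴᵀ * Qᴴ) * (U * (Yᴴᵀ * Qᴴ))ᴴ := by rw [hU1, hU2]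
    _ = U * (Xᴴᵀ * ((Qᴴ * Q) * Yᵀ)) * Uᴴ := by
      simp only [Matrix.conjTranspose_mul, Matrix.conjTranspose_conjTranspose, h2,
        Matrix.mul_assoc]
    _ = U * (Y * Xᴴ)ᵀ * Uᴴ := by rw [hQ2, Matrix.one_mul, Matrix.transpose_mul]

/-! ### Matrices of size at most two -/

/-- For symmetric `Q`, the relation `Q * Bᵀ = B * Q` says that `B * Q` is symmetric: one complex
linear equation. The matrices `Q` below are symmetric, form a real 3-dimensional space, and are
unitary up to scale when nonzero. Two real equations in three real unknowns have a nonzero solution.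
-/
theorem Matrix.exists_unitary_transpose_fin_two (B : Matrix (Fin 2) (Fin 2) ℂ) :
    ∃ Q ∈ Matrix.unitaryGroup (Fin 2) ℂ, B = Q * Bᵀ * Qᴴ := by
  set t := B 0 0 - B 1 1 with ht
  set b := B 0 1 with hb
  set c := B 1 0 with hc
  obtain ⟨x, hx0, hx⟩ : ∃ x : Fin 3 → ℝ, x ≠ 0 ∧
      t * x 0 + b * (x 1 + x 2 * Complex.I) + c * (x 1 - x 2 * Complex.I) = 0 := by
    let f : (Fin 3 → ℝ) →ₗ[ℝ] ℂ :=
      { toFun := fun x =>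
          t * x 0 + b * (x 1 + x 2 * Complex.I) + c * (x 1 - x 2 * Complex.I)
        map_add' := fun x y => by simp only [Pi.add_apply]; push_cast; ring
        map_smul' := fun r x => by
          simp only [Pi.smul_apply, smul_eq_mul, RingHom.id_apply, Complex.real_smul]
          push_cast; ring }
    have hf : LinearMap.ker f ≠ ⊥ := LinearMap.ker_ne_bot_of_finrank_lt (by simp)
    obtain ⟨x, hx, hx0⟩ := (Submodule.ne_bot_iff _).1 hf
    exact ⟨x, hx0, hx⟩
  set N : ℝ := x 0 ^ 2 + x 1 ^ 2 + x 2 ^ 2 with hN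
  have hNpos : 0 < N := by
    by_contra hle
    apply hx0
    have h0 : x 0 = 0 := by nlinarith [sq_nonneg (x 0), sq_nonneg (x 1), sq_nonneg (x 2)]
    have h1 : x 1 = 0 := by nlinarith [sq_nonneg (x 0), sq_nonneg (x 1), sq_nonneg (x 2)]
    have h2 : x 2 = 0 := by nlinarith [sq_nonneg (x 0), sq_nonneg (x 1), sq_nonneg (x 2)]
    ext i; fin_cases i <;> assumption
  set s : ℝ := (Real.sqrt N)⁻¹ with hs
  have hsN : (s : ℂ) ^ 2 * ((x 0 : ℂ) ^ 2 + (x 1 : ℂ) ^ 2 + (x 2 : ℂ) ^ 2) = 1 := by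
    have : s ^ 2 * N = 1 := by
      rw [hs, inv_pow, Real.sq_sqrt hNpos.le, inv_mul_cancel₀ hNpos.ne']
    rw [hN] at this
    exact_mod_cast this
  have hI := Complex.I_sq
  let Q : Matrix (Fin 2) (Fin 2) ℂ :=
    !![-(s * (x 1 - x 2 * Complex.I)), s * x 0; s * x 0, s * (x 1 + x 2 * Complex.I)]
  have hQ : Q * Qᴴ = 1 := by
    ext i j
    fin_cases i <;> fin_cases j <;>
      simp [Q, Matrix.mul_apply, Fin.sum_univ_two]
    · linear_combination hsN - s ^ 2 * x 2 ^ 2 * hI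
    · ring
    · ring
    · linear_combination hsN - s ^ 2 * x 2 ^ 2 * hI
  have hBQ : Q * Bᵀ = B * Q := by
    ext i j
    fin_cases i <;> fin_cases j <;>
      simp [Q, Matrix.mul_apply, Fin.sum_univ_two, ← hb, ← hc]
    · ring
    · linear_combination (-s : ℂ) * hx + (s * x 0 : ℂ) * ht
    · linear_combination (s : ℂ) * hx - (s * x 0 : ℂ) * ht
    · ring
  refine ⟨Q, Matrix.mem_unitaryGroup_iff.2 hQ, ?_⟩
  rw [hBQ, Matrix.mul_assoc, hQ, Matrix.mul_one]

theorem Matrix.exists_unitary_transpose_of_card_le_two {m : Type*} [Fintype m] [DecidableEq m]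
    (hm : Fintype.card m ≤ 2) (B : Matrix m m ℂ) :
    ∃ Q ∈ Matrix.unitaryGroup m ℂ, B = Q * Bᵀ * Qᴴ := by
  rcases hm.lt_or_eq with h | h
  · have : Subsingleton m := Fintype.card_le_one_iff_subsingleton.1 (by omega)
    refine ⟨1, one_mem _, ?_⟩
    ext i j
    simp [Subsingleton.elim i j]
  · let e := Fintype.equivFinOfCardEq h
    obtain ⟨Q, hQ, hB⟩ := Matrix.exists_unitary_transpose_fin_two (B.submatrix e.symm e.symm)
    refine ⟨Q.submatrix e e, ?_, ?_⟩
    · rw [Matrix.mem_unitaryGroup_iff, Matrix.star_eq_conjTranspose] at hQ ⊢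
      rw [Matrix.conjTranspose_submatrix, Matrix.submatrix_mul_equiv, hQ,
        Matrix.submatrix_one_equiv]
    · have h1 := congrArg (fun M => M.submatrix e e) hB
      simp only [Matrix.submatrix_submatrix, Equiv.symm_comp_self, Matrix.submatrix_id_id] at h1
      rw [← Matrix.submatrix_mul_equiv _ _ e e e, ← Matrix.submatrix_mul_equiv _ _ e e e] at h1
      simpa [Matrix.transpose_submatrix, Matrix.conjTranspose_submatrix,
        Matrix.submatrix_submatrix] using h1

/-! ### Unitary diagonalization -/

theorem LinearMap.IsSymmetric.exists_orthonormalBasis_of_commute {E : Type*}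
    [NormedAddCommGroup E] [InnerProductSpace ℂ E] [FiniteDimensional ℂ E] {n : ℕ}
    (hn : Module.finrank ℂ E = n) {S T : E →ₗ[ℂ] E} (hS : S.IsSymmetric) (hT : T.IsSymmetric)
    (hST : Commute S T) :
    ∃ b : OrthonormalBasis (Fin n) ℂ E, ∃ α β : Fin n → ℂ,
      ∀ i, S (b i) = α i • b i ∧ T (b i) = β i • b i := by
  classical
  have hint := LinearMap.IsSymmetric.directSum_isInternal_of_commute hS hT hST
  have horth := LinearMap.IsSymmetric.orthogonalFamily_eigenspace_inf_eigenspace hS hT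
  set V := fun i : ℂ × ℂ => Module.End.eigenspace S i.2 ⊓ Module.End.eigenspace T i.1 with hV
  -- The joint eigenspaces are indexed by all of `ℂ × ℂ`; discarding the zero ones leaves a finite
  -- index type.
  have hint' := (DirectSum.isInternal_ne_bot_iff (A := V)).2 hint
  have hfin : {i | V i ≠ ⊥}.Finite :=
    WellFoundedGT.finite_ne_bot_of_iSupIndep hint.submodule_iSupIndep
  have : Fintype {i // V i ≠ ⊥} := hfin.fintype
  have horth' : OrthogonalFamily ℂ (fun i : {i // V i ≠ ⊥} => V i)
      fun i => (V i).subtypeₗᵢ := horth.comp Subtype.val_injective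
  refine ⟨hint'.subordinateOrthonormalBasis hn horth',
    fun i => (hint'.subordinateOrthonormalBasisIndex hn i horth').1.2,
    fun i => (hint'.subordinateOrthonormalBasisIndex hn i horth').1.1, fun i => ?_⟩
  have := hint'.subordinateOrthonormalBasis_subordinate hn i horth'
  exact ⟨Module.End.mem_eigenspace_iff.1 this.1, Module.End.mem_eigenspace_iff.1 this.2⟩

theorem Matrix.exists_unitary_diagonal_of_mem_unitaryGroup {n : ℕ} {W : Matrix (Fin n) (Fin n) ℂ}
    (hW : W ∈ Matrix.unitaryGroup (Fin n) ℂ) :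
    ∃ V ∈ Matrix.unitaryGroup (Fin n) ℂ, ∃ d : Fin n → ℂ,
      W = V * Matrix.diagonal d * Vᴴ := by
  have hW1 : W * Wᴴ = 1 := Matrix.mem_unitaryGroup_iff.1 hW
  have hW2 : Wᴴ * W = 1 := Matrix.mem_unitaryGroup_iff'.1 hW
  -- Since `W` is normal, `H` and `K` are commuting Hermitian matrices, with `W = (H - I K) / 2`.
  let H := W + Wᴴ
  let K := Complex.I • (W - Wᴴ)
  have hH : H.IsHermitian := by
    simp only [H, Matrix.IsHermitian, Matrix.conjTranspose_add,
      Matrix.conjTranspose_conjTranspose, add_comm]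
  have hK : K.IsHermitian := by
    simp only [K, Matrix.IsHermitian, Matrix.conjTranspose_smul, Matrix.conjTranspose_sub,
      Matrix.conjTranspose_conjTranspose, Complex.star_def, Complex.conj_I, neg_smul,
      ← smul_neg, neg_sub]
  have hHK : H * K = K * H := by
    simp only [H, K, Matrix.mul_smul, Matrix.smul_mul, add_mul, mul_add, sub_mul, mul_sub,
      hW1, hW2]
  have hcomm : Commute (Matrix.toEuclideanLin H) (Matrix.toEuclideanLin K) := by
    refine LinearMap.ext fun x => ?_
    simp only [Module.End.mul_apply, Matrix.toLpLin_apply, Matrix.mulVec_mulVec, hHK]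
  obtain ⟨b, α, β, hb⟩ := LinearMap.IsSymmetric.exists_orthonormalBasis_of_commute
    (finrank_euclideanSpace_fin) (Matrix.isSymmetric_toEuclideanLin_iff.2 hH)
    (Matrix.isSymmetric_toEuclideanLin_iff.2 hK) hcomm
  let V : Matrix (Fin n) (Fin n) ℂ := (EuclideanSpace.basisFun (Fin n) ℂ).toBasis.toMatrix b
  have hV : V ∈ Matrix.unitaryGroup (Fin n) ℂ :=
    (EuclideanSpace.basisFun (Fin n) ℂ).toMatrix_orthonormalBasis_mem_unitary b
  have hVV : V * Vᴴ = 1 := Matrix.mem_unitaryGroup_iff.1 hV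
  have hcol : ∀ j, V.col j = (b j).ofLp := fun j => rfl
  have hWV : ∀ j, W *ᵥ (b j).ofLp = ((α j - Complex.I * β j) / 2) • (b j).ofLp := by
    intro j
    have h1 : H *ᵥ (b j).ofLp = α j • (b j).ofLp := congrArg WithLp.ofLp (hb j).1
    have h2 : K *ᵥ (b j).ofLp = β j • (b j).ofLp := congrArg WithLp.ofLp (hb j).2
    have h3 : W = (1 / 2 : ℂ) • (H - Complex.I • K) := by
      simp only [H, K, smul_smul, Complex.I_mul_I]
      module
    rw [h3, Matrix.smul_mulVec, Matrix.sub_mulVec, Matrix.smul_mulVec, h1, h2]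
    module
  refine ⟨V, hV, fun j => (α j - Complex.I * β j) / 2, ?_⟩
  have h : W * V = V * Matrix.diagonal fun j => (α j - Complex.I * β j) / 2 := by
    ext i j
    rw [Matrix.mul_diagonal]
    exact (congrFun (hWV j) i).trans (mul_comm _ _)
  rw [← h, Matrix.mul_assoc, hVV, Matrix.mul_one]

/-- With `W = V * diagonal d * Vᴴ`, every `Z = V * diagonal p * Vᵀ` intertwines `Wᵀ` and `W`; the
free phases `p` are then adjusted to the coordinates of `v` in the eigenbasis. -/
theorem Matrix.exists_unitary_symmetrizing_unitary_and_vector {n : ℕ}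
    {W : Matrix (Fin n) (Fin n) ℂ} (hW : W ∈ Matrix.unitaryGroup (Fin n) ℂ) (v : Fin n → ℂ) :
    ∃ Z ∈ Matrix.unitaryGroup (Fin n) ℂ, Z * Wᵀ = W * Z ∧ Z *ᵥ star v = v := by
  obtain ⟨V, hV, d, rfl⟩ := Matrix.exists_unitary_diagonal_of_mem_unitaryGroup hW
  have hV1 : V * Vᴴ = 1 := Matrix.mem_unitaryGroup_iff.1 hV
  have hV2 : Vᴴ * V = 1 := Matrix.mem_unitaryGroup_iff'.1 hV
  have hV3 : Vᵀ * Vᴴᵀ = 1 := by rw [← Matrix.transpose_mul, hV2, Matrix.transpose_one]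
  let w := Vᴴ *ᵥ v
  -- The phase carrying `star (w i)` to `w i`; where `w i = 0` any phase would do, and 1 keeps
  -- `diagonal p` unitary.
  let p : Fin n → ℂ := fun i => if w i = 0 then 1 else w i / star (w i)
  have hp : ∀ i, p i * star (p i) = 1 := by
    intro i
    by_cases h : w i = 0
    · simp [p, h]
    · have : (starRingEnd ℂ) (w i) ≠ 0 := by simpa using h
      simp only [p, if_neg h, Complex.star_def, map_div₀, Complex.conj_conj]
      field_simp
  have hpw : Matrix.diagonal p *ᵥ star w = w := by
    ext i
    rw [Matrix.mulVec_diagonal]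
    by_cases h : w i = 0
    · simp [h]
    · have : (starRingEnd ℂ) (w i) ≠ 0 := by simpa using h
      simp only [p, if_neg h, Complex.star_def, Pi.star_apply]
      field_simp
  refine ⟨V * Matrix.diagonal p * Vᵀ, ?_, ?_, ?_⟩
  · refine mul_mem (mul_mem hV ?_) (Matrix.transpose_mem_unitaryGroup_iff.2 hV)
    rw [Matrix.mem_unitaryGroup_iff, Matrix.star_eq_conjTranspose,
      Matrix.diagonal_conjTranspose, Matrix.diagonal_mul_diagonal]
    simp only [Pi.star_apply, hp, Matrix.diagonal_one]
  · calc V * Matrix.diagonal p * Vᵀ * (V * Matrix.diagonal d * Vᴴ)ᵀ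
        = V * (Matrix.diagonal p * ((Vᵀ * Vᴴᵀ) * (Matrix.diagonal d * Vᵀ))) := by
          simp only [Matrix.transpose_mul, Matrix.diagonal_transpose, Matrix.mul_assoc]
      _ = V * ((Matrix.diagonal p * Matrix.diagonal d) * Vᵀ) := by
          rw [hV3, Matrix.one_mul, Matrix.mul_assoc]
      _ = V * ((Matrix.diagonal d * Matrix.diagonal p) * Vᵀ) := by
          simp only [Matrix.diagonal_mul_diagonal, mul_comm]
      _ = V * (Matrix.diagonal d * ((Vᴴ * V) * (Matrix.diagonal p * Vᵀ))) := by
          rw [hV2, Matrix.one_mul, Matrix.mul_assoc]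
      _ = V * Matrix.diagonal d * Vᴴ * (V * Matrix.diagonal p * Vᵀ) := by
          simp only [Matrix.mul_assoc]
  · have h1 : Vᵀ *ᵥ star v = star w := by
      rw [Matrix.star_mulVec, Matrix.conjTranspose_conjTranspose, Matrix.mulVec_transpose]
    rw [← Matrix.mulVec_mulVec, ← Matrix.mulVec_mulVec, h1, hpw, Matrix.mulVec_mulVec, hV1,
      Matrix.one_mulVec]

theorem Matrix.IsHermitian.exists_unitary_diagonal_indicator {n : ℕ}
    {P : Matrix (Fin n) (Fin n) ℂ} (hP : P.IsHermitian) (hPP : P * P = P) :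
    ∃ V ∈ Matrix.unitaryGroup (Fin n) ℂ, ∃ s : Finset (Fin n),
      P = V * Matrix.diagonal (fun i => if i ∈ s then 1 else 0) * Vᴴ := by
  have hV := hP.eigenvectorUnitary.2
  have hV2 := Matrix.mem_unitaryGroup_iff'.1 hV
  have hsp := hP.spectral_theorem
  rw [Unitary.conjStarAlgAut_apply] at hsp
  set V : Matrix (Fin n) (Fin n) ℂ := hP.eigenvectorUnitary.1
  set D : Matrix (Fin n) (Fin n) ℂ := Matrix.diagonal (RCLike.ofReal ∘ hP.eigenvalues) with hD
  have hDD : D * D = D := by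
    have h1 : star V * P * V = D := by
      rw [hsp]
      simp only [Matrix.mul_assoc, hV2, Matrix.mul_one]
      rw [← Matrix.mul_assoc, hV2, Matrix.one_mul]
    have h2 : V * star V = 1 := Matrix.mem_unitaryGroup_iff.1 hV
    calc D * D = star V * P * (V * star V) * P * V := by
          rw [← h1]; simp only [Matrix.mul_assoc]
      _ = star V * (P * P) * V := by rw [h2, Matrix.mul_one, Matrix.mul_assoc (star V)]
      _ = D := by rw [hPP, h1]
  refine ⟨V, hV, Finset.univ.filter (fun i => hP.eigenvalues i ≠ 0), ?_⟩
  have hD' : D = Matrix.diagonal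
      (fun i => if i ∈ Finset.univ.filter (fun i => hP.eigenvalues i ≠ 0) then 1 else 0) := by
    rw [hD]
    -- Idempotence forces each eigenvalue to be 0 or 1.
    congr 1
    ext i
    have h1 : ((hP.eigenvalues i : ℂ)) * hP.eigenvalues i = hP.eigenvalues i := by
      have h2 := congrFun (congrFun hDD i) i
      simp only [hD, Matrix.diagonal_mul_diagonal, Matrix.diagonal_apply_eq] at h2
      exact h2
    by_cases h : hP.eigenvalues i = 0
    · simp [h]
    · have h3 : (hP.eigenvalues i : ℂ) ≠ 0 := by exact_mod_cast h
      simpa [h] using mul_right_cancel₀ h3 (h1.trans (one_mul _).symm)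
  rw [← hD']
  exact hsp

/-! ### The two cases for a partial isometry -/

namespace IsPartialIsometry

variable {n : ℕ} {A : Matrix (Fin n) (Fin n) ℂ}

theorem initialProjection_mul_self (hA : IsPartialIsometry A) : Aᴴ * A * (Aᴴ * A) = Aᴴ * A := by
  rw [Matrix.mul_assoc, ← Matrix.mul_assoc A, hA]

theorem unitarilySimilar_transpose_of_rank_le_two (hA : IsPartialIsometry A)
    {V : Matrix (Fin n) (Fin n) ℂ} (hV : V ∈ Matrix.unitaryGroup (Fin n) ℂ) {s : Finset (Fin n)}
    (hs : s.card ≤ 2)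
    (hP : Aᴴ * A = V * Matrix.diagonal (fun i => if i ∈ s then 1 else 0) * Vᴴ) :
    UnitarilySimilar A Aᵀ := by
  have hV2 : Vᴴ * V = 1 := Matrix.mem_unitaryGroup_iff'.1 hV
  -- The columns of `V` indexed by `s` are an orthonormal basis of the initial space; `A` is
  -- isometric there, so `Y = A * X` also has orthonormal columns.
  let X : Matrix (Fin n) s ℂ := V.submatrix id Subtype.val
  have hX : Xᴴ * X = 1 := by
    have h1 : Xᴴ * X = (Vᴴ * V).submatrix Subtype.val Subtype.val := rfl
    rw [h1, hV2, Matrix.submatrix_one _ Subtype.val_injective]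
  have hXX : X * Xᴴ = Aᴴ * A := by
    ext i j
    rw [hP, Matrix.mul_apply, Matrix.mul_apply]
    simp only [Matrix.mul_diagonal, mul_ite, mul_one, mul_zero, ite_mul, zero_mul]
    rw [Finset.sum_ite_mem, Finset.univ_inter, ← Finset.sum_coe_sort s]
    rfl
  have hAX : A = A * X * Xᴴ := by
    rw [Matrix.mul_assoc, hXX, ← Matrix.mul_assoc, hA]
  have hY : (A * X)ᴴ * (A * X) = 1 := by
    calc (A * X)ᴴ * (A * X) = Xᴴ * (Aᴴ * A) * X := by
          simp only [Matrix.conjTranspose_mul, Matrix.mul_assoc]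
      _ = (Xᴴ * X) * (Xᴴ * X) := by rw [← hXX]; simp only [Matrix.mul_assoc]
      _ = 1 := by rw [hX, Matrix.one_mul]
  obtain ⟨Q, hQ, hB⟩ := Matrix.exists_unitary_transpose_of_card_le_two
    (by rwa [Fintype.card_coe]) (Xᴴ * (A * X))
  have h := Matrix.exists_unitary_mul_conjTranspose_transpose hX hY hQ hB
  rwa [← hAX] at h

theorem unitarilySimilar_transpose_of_initialProjection_eq (hA : IsPartialIsometry A)
    {v : Fin n → ℂ} (hP : Aᴴ * A = 1 - Matrix.vecMulVec v (star v)) :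
    UnitarilySimilar A Aᵀ := by
  have hPP := hA.initialProjection_mul_self
  have hPH : (Aᴴ * A)ᴴ = Aᴴ * A := (Matrix.isHermitian_conjTranspose_mul_self A).eq
  -- Polar decomposition: `P` and `A` have the same Gram matrix, so `A = W * P` with `W` unitary.
  obtain ⟨W, hW, hWA⟩ := Matrix.exists_unitary_mul_eq_of_gram_eq (M := Aᴴ * A) (N := A)
    (by rw [hPH, hPP])
  obtain ⟨Z, hZ, hZW, hZv⟩ := Matrix.exists_unitary_symmetrizing_unitary_and_vector hW v
  have hZ1 : Z * Zᴴ = 1 := Matrix.mem_unitaryGroup_iff.1 hZ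
  have hZP : Z * (Aᴴ * A)ᵀ * Zᴴ = Aᴴ * A := by
    have hvZ : v ᵥ* Zᴴ = star v := by
      rw [← hZv, Matrix.star_mulVec, star_star, hZv]
    rw [hP, Matrix.transpose_sub, Matrix.transpose_one, Matrix.transpose_vecMulVec,
      Matrix.mul_sub, Matrix.sub_mul, Matrix.mul_one, hZ1, Matrix.mul_vecMulVec,
      Matrix.vecMulVec_mul, hZv, hvZ]
  have hZA : Z * Aᵀ * Zᴴ = Aᴴ * A * W := by
    have hZ2 : Zᴴ * Z = 1 := Matrix.mem_unitaryGroup_iff'.1 hZ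
    calc Z * Aᵀ * Zᴴ = Z * (Aᴴ * A)ᵀ * ((Zᴴ * Z) * Wᵀ) * Zᴴ := by
          rw [hZ2, Matrix.one_mul, Matrix.mul_assoc Z (Aᴴ * A)ᵀ Wᵀ, ← Matrix.transpose_mul, hWA]
      _ = Z * (Aᴴ * A)ᵀ * Zᴴ * (Z * Wᵀ) * Zᴴ := by simp only [Matrix.mul_assoc]
      _ = Aᴴ * A * W := by rw [hZP, hZW, Matrix.mul_assoc, Matrix.mul_assoc W, hZ1, Matrix.mul_one]
  refine ⟨W * Z, mul_mem hW hZ, ?_⟩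
  have hW1 : W * Wᴴ = 1 := Matrix.mem_unitaryGroup_iff.1 hW
  calc A = W * (Aᴴ * A) * (W * Wᴴ) := by rw [hW1, Matrix.mul_one, hWA]
    _ = W * (Z * Aᵀ * Zᴴ) * Wᴴ := by rw [hZA]; simp only [Matrix.mul_assoc]
    _ = W * Z * Aᵀ * (W * Z)ᴴ := by simp only [Matrix.conjTranspose_mul, Matrix.mul_assoc]

theorem unitarilySimilar_transpose_of_corank_le_one (hA : IsPartialIsometry A)
    {V : Matrix (Fin n) (Fin n) ℂ} (hV : V ∈ Matrix.unitaryGroup (Fin n) ℂ) {s : Finset (Fin n)}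
    (hs : sᶜ.card ≤ 1)
    (hP : Aᴴ * A = V * Matrix.diagonal (fun i => if i ∈ s then 1 else 0) * Vᴴ) :
    UnitarilySimilar A Aᵀ := by
  have hV1 : V * Vᴴ = 1 := Matrix.mem_unitaryGroup_iff.1 hV
  have hdiag : ∀ w : Fin n → ℂ,
      Matrix.diagonal (fun i => if i ∈ s then 1 else 0) = 1 - Matrix.vecMulVec w (star w) →
      UnitarilySimilar A Aᵀ := by
    intro w hw
    refine hA.unitarilySimilar_transpose_of_initialProjection_eq (v := V *ᵥ w) ?_
    rw [hP, hw, Matrix.mul_sub, Matrix.sub_mul, Matrix.mul_one, hV1, Matrix.mul_vecMulVec,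
      Matrix.vecMulVec_mul, Matrix.star_mulVec]
  -- The vector is 0 when `P = 1`, and otherwise the basis vector of the one missing index,
  -- transported by `V`.
  rcases Nat.le_one_iff_eq_zero_or_eq_one.1 hs with h | h
  · refine hdiag 0 ?_
    rw [Finset.card_eq_zero, Finset.compl_eq_empty_iff] at h
    simp [h]
  · obtain ⟨k, hk⟩ := Finset.card_eq_one.1 h
    have hmem : ∀ i, i ∈ s ↔ i ≠ k := fun i => by
      rw [Ne, ← Finset.mem_singleton, ← hk, Finset.mem_compl, not_not]
    refine hdiag (Pi.single k 1) ?_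
    ext i j
    simp only [hmem, Matrix.diagonal_apply, Matrix.sub_apply, Matrix.one_apply,
      Matrix.vecMulVec_apply, Pi.star_apply, Pi.single_apply]
    by_cases hij : i = j <;> by_cases hi : i = k <;> by_cases hj : j = k <;> simp_all

end IsPartialIsometry

theorem mainTheorem8 (n : ℕ) (hn1 : 1 ≤ n) (hn4 : n ≤ 4)
    (A : Matrix (Fin n) (Fin n) ℂ) (hA : IsPartialIsometry A) :
    UnitarilySimilar A Aᵀ := by
  obtain ⟨V, hV, s, hP⟩ := Matrix.IsHermitian.exists_unitary_diagonal_indicator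
    (Matrix.isHermitian_conjTranspose_mul_self A) hA.initialProjection_mul_self
  by_cases hs : s.card ≤ 2
  · exact hA.unitarilySimilar_transpose_of_rank_le_two hV hs hP
  · refine hA.unitarilySimilar_transpose_of_corank_le_one hV ?_ hP
    rw [Finset.card_compl, Fintype.card_fin]
    omega
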